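/- Let $\mathbb{F}$ be an arbitrary field of characteristic $2$, let $n \ge 0$ be an integer, and let $A \in \mathrm{M}_n(\mathbb{F})$ be an $n \times n$ matrix over $\mathbb{F}$ whose trace belongs to $\{0,1\}$. Denote by $A \oplus 0_n$ the block-diagonal matrix $\begin{bmatrix} A & 0 \\ 0 & 0_n \end{bmatrix} \in \mathrm{M}_{2n}(\mathbb{F})$, where $0_n$ is the $n \times n$ zero matrix. Then $A \oplus 0_n$ is the sum of three idempotent matrices of $\mathrm{M}_{2n}(\mathbb{F})$, that is, there are $P, Q, R \in \mathrm{M}_{2n}(\mathbb{F})$ with $P^2 = P$, $Q^2 = Q$, $R^2 = R$ and $A \oplus 0_n = P + Q + R$. -/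

import Mathlib

/-- For `n` by `n` matrices `A` and `B`, the block-diagonal matrix `A ⊕ B = [A, 0; 0, B]`
as a `2n` by `2n` matrix: the first `n` indices are those of `A`, the last `n` those of `B`. -/
def directSum {F : Type*} [Zero F] {n : ℕ} (A B : Matrix (Fin n) (Fin n) F) :
    Matrix (Fin (2 * n)) (Fin (2 * n)) F :=
  Matrix.reindex (finSumFinEquiv.trans (finCongr (two_mul n).symm))
    (finSumFinEquiv.trans (finCongr (two_mul n).symm)) (Matrix.fromBlocks A 0 0 B)

open Matrix

/-! Write `A = B * C` with `B` of full column rank and `C` of full row rank `r`. In characteristic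
2, `C * B - 1` again has trace 0 or 1, so by `isCommutatorAddIdempotent_of_trace` it equals `x * y -
y * x + w` with `x * w = 0` and `w` idempotent. With `Z = (y * x + w) * B'` and `B' * B = 1`, this
makes `B * (C + Z)` and `B * Z` the diagonal blocks of an idempotent. Two more idempotents replace
its off-diagonal blocks by arbitrary ones, as their identity corners cancel. The choice giving two
equal block rows `[B * (C + Z), B * Z]` is similar to `A ⊕ 0`.

The commutator form comes from a Hessenberg basis, reordered so that the diagonal blocks are upper
triangular, the second strictly. Then `x` is the direct sum of `J` and `1 + J'` with `J`, `J'`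
shifts: their spectra are disjoint, so the off-diagonal blocks pose no obstruction, and the diagonal
ones only a trace condition. -/

/-- An element of a ring that is a commutator `x * y - y * x` plus an idempotent killed by `x`. -/
def IsCommutatorAddIdempotent {R : Type*} [Ring R] (t : R) : Prop :=
  ∃ x y w : R, t = x * y - y * x + w ∧ x * w = 0 ∧ IsIdempotentElem w

theorem IsCommutatorAddIdempotent.map {R S : Type*} [Ring R] [Ring S] {t : R}
    (ht : IsCommutatorAddIdempotent t) (f : R →+* S) : IsCommutatorAddIdempotent (f t) := by
  obtain ⟨x, y, w, rfl, hxw, hw⟩ := ht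
  refine ⟨f x, f y, f w, by simp, by rw [← map_mul, hxw, map_zero], hw.map f⟩

/-! ### Commutators with the shift matrix -/

/-- The shift matrix, with ones just above the diagonal. -/
def shiftMatrix (R : Type*) [Zero R] [One R] (p : ℕ) : Matrix (Fin p) (Fin p) R :=
  Matrix.of fun i j => if (i : ℕ) + 1 = j then 1 else 0

section Shift
variable {R : Type*} [Ring R] {p : ℕ}

theorem shiftMatrix_mul_apply {ι : Type*} {M : Matrix (Fin p) ι R} {f : ℕ → ι → R}
    (hM : ∀ i j, M i j = f i j) (hf : ∀ j, f p j = 0) (i : Fin p) (j : ι) :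
    (shiftMatrix R p * M) i j = f (i + 1) j := by
  rw [mul_apply]
  by_cases h : (i : ℕ) + 1 < p
  · rw [Finset.sum_eq_single ⟨i + 1, h⟩]
    · simp [shiftMatrix, hM]
    · intro b _ hb
      have : (i : ℕ) + 1 ≠ b := fun e => hb (Fin.ext e.symm)
      simp [shiftMatrix, this]
    · simp
  · have h1 : (i : ℕ) + 1 = p := by omega
    rw [h1, hf]
    refine Finset.sum_eq_zero fun b _ => ?_
    have : (i : ℕ) + 1 ≠ b := by omega
    simp [shiftMatrix, this]

theorem mul_shiftMatrix_apply {ι : Type*} {M : Matrix ι (Fin p) R} {f : ι → ℕ → R}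
    (hM : ∀ i j, M i j = f i j) (i : ι) (j : Fin p) :
    (M * shiftMatrix R p) i j = if (j : ℕ) = 0 then 0 else f i (j - 1) := by
  rw [mul_apply]
  obtain ⟨j, hj⟩ := j
  cases j with
  | zero => simp [shiftMatrix]
  | succ j =>
    rw [Finset.sum_eq_single ⟨j, by omega⟩]
    · simp [shiftMatrix, hM]
    · intro b _ hb
      have : (b : ℕ) ≠ j := fun e => hb (Fin.ext e)
      simp [shiftMatrix, this]
    · simp

theorem shiftMatrix_pow_apply (k : ℕ) (i j : Fin p) :
    (shiftMatrix R p ^ k) i j = if (i : ℕ) + k = j then 1 else 0 := by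
  induction k generalizing i j with
  | zero => simp [one_apply, Fin.ext_iff]
  | succ k ih =>
    rw [pow_succ', shiftMatrix_mul_apply
      (f := fun a (b : Fin p) => if a + k = b then (1 : R) else 0) ih]
    · simp only [show (i : ℕ) + 1 + k = i + (k + 1) by omega]
    · intro b
      have : p + k ≠ b := by omega
      simp [this]

theorem shiftMatrix_isNilpotent : IsNilpotent (shiftMatrix R p) := by
  refine ⟨p, ?_⟩
  ext i j
  have : (i : ℕ) + p ≠ j := by omega
  simp [shiftMatrix_pow_apply, this]

/-- An upper triangular matrix of trace zero is a commutator with the shift matrix. -/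
theorem exists_shiftMatrix_commutator (T : Matrix (Fin p) (Fin p) R)
    (hT : ∀ i j, j < i → T i j = 0) (htr : T.trace = 0) :
    ∃ Y, T = shiftMatrix R p * Y - Y * shiftMatrix R p := by
  let t : ℕ → ℕ → R := fun i j => if h : i < p ∧ j < p then T ⟨i, h.1⟩ ⟨j, h.2⟩ else 0
  have ht (i j : Fin p) : t i j = T i j := by simp [t]
  -- The equation reads `t i j = y (i + 1) j - y i (j - 1)`, so `y` is a partial sum of `t` along a
  -- diagonal, starting from a zero row 0.
  let y : ℕ → ℕ → R := fun i j => ∑ s ∈ Finset.range (min i (j + 1)), t (i - 1 - s) (j - s)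
  have y_zero (i : ℕ) : y (i + 1) 0 = t i 0 := by simp [y]
  have y_succ (i j : ℕ) : y (i + 1) (j + 1) = t i (j + 1) + y i j := by
    simp only [y]
    rw [show min (i + 1) (j + 1 + 1) = min i (j + 1) + 1 by omega, Finset.sum_range_succ', add_comm]
    congr 1
    refine Finset.sum_congr rfl fun s _ => ?_
    congr 1 <;> omega
  -- Row `p` must vanish: its last entry is the trace, the others sum entries below the diagonal.
  have y_last (j : ℕ) (hj : j < p) : y p j = 0 := by
    by_cases h : j + 1 = p
    · subst h
      have : y (j + 1) j = ∑ i : Fin (j + 1), t i i := by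
        rw [Fin.sum_univ_eq_sum_range (fun i => t i i), ← Finset.sum_range_reflect]
        simp only [y, min_self]
        refine Finset.sum_congr rfl fun s _ => ?_
        congr 1
      rw [this]
      simpa [ht, trace] using htr
    · refine Finset.sum_eq_zero fun s hs => ?_
      have hs' := Finset.mem_range.1 hs
      simp only [t]
      split_ifs with h'
      · exact hT _ _ (by simp only [Fin.mk_lt_mk]; omega)
      · rfl
  let Y : Matrix (Fin p) (Fin p) R := Matrix.of fun i j => y i j
  refine ⟨Y, ?_⟩
  ext i j
  have h1 : (shiftMatrix R p * Y) i j = y (i + 1) j :=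
    shiftMatrix_mul_apply (f := fun i (j : Fin p) => y i j) (fun _ _ => rfl)
      (fun j => y_last j j.2) i j
  have h2 : (Y * shiftMatrix R p) i j = if (j : ℕ) = 0 then 0 else y i (j - 1) :=
    mul_shiftMatrix_apply (f := fun (i : Fin p) j => y i j) (fun _ _ => rfl) i j
  rw [Matrix.sub_apply, h1, h2, ← ht]
  rcases (j : ℕ) with _ | k
  · simp [y_zero]
  · simp [y_succ]

end Shift

/-! ### Sylvester equations and block matrices -/

/-- If `a` and `b` are nilpotent then `y ↦ a * y - y * b + y` is surjective. -/
theorem exists_sylvester_of_isNilpotent {R m n : Type*} [Ring R] [Fintype m] [DecidableEq m]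
    [Fintype n] [DecidableEq n] {a : Matrix m m R} {b : Matrix n n R} (ha : IsNilpotent a)
    (hb : IsNilpotent b) (t : Matrix m n R) : ∃ y : Matrix m n R, a * y - y * b + y = t := by
  let f : AddMonoid.End (Matrix m n R) := addMonoidHomMulLeft a
  let g : AddMonoid.End (Matrix m n R) := addMonoidHomMulRight b
  have hf : IsNilpotent f := by
    obtain ⟨k, hk⟩ := ha
    have (k : ℕ) (y : Matrix m n R) : (f ^ k) y = a ^ k * y := by
      induction k with
      | zero => simp
      | succ k ih =>
        rw [pow_succ', pow_succ', AddMonoid.End.coe_mul, Function.comp_apply, ih, Matrix.mul_assoc]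
        rfl
    exact ⟨k, by ext1 y; rw [this, hk, Matrix.zero_mul]; rfl⟩
  have hg : IsNilpotent g := by
    obtain ⟨k, hk⟩ := hb
    have (k : ℕ) (y : Matrix m n R) : (g ^ k) y = y * b ^ k := by
      induction k with
      | zero => simp
      | succ k ih =>
        rw [pow_succ', pow_succ, AddMonoid.End.coe_mul, Function.comp_apply, ih, ← Matrix.mul_assoc]
        rfl
    exact ⟨k, by ext1 y; rw [this, hk, Matrix.mul_zero]; rfl⟩
  have hfg : Commute f g := by
    ext1 y
    exact (Matrix.mul_assoc a y b).symm
  obtain ⟨u, hu⟩ := (hfg.isNilpotent_sub hf hg).isUnit_add_one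
  refine ⟨(↑u⁻¹ : AddMonoid.End (Matrix m n R)) t, ?_⟩
  have : (f - g + 1) ((↑u⁻¹ : AddMonoid.End (Matrix m n R)) t) = t := by
    rw [← hu]
    exact DFunLike.congr_fun u.mul_inv t
  exact this

/-- Block matrices with upper triangular diagonal blocks, the second strictly so. -/
theorem isCommutatorAddIdempotent_fromBlocks {R : Type*} [Ring R] {p q : ℕ}
    (A : Matrix (Fin p) (Fin p) R) (B : Matrix (Fin p) (Fin q) R) (C : Matrix (Fin q) (Fin p) R)
    (D : Matrix (Fin q) (Fin q) R) (hA : ∀ i j, j < i → A i j = 0)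
    (hD : ∀ i j, j ≤ i → D i j = 0) (htr : A.trace = 0 ∨ A.trace = 1) :
    IsCommutatorAddIdempotent (fromBlocks A B C D) := by
  obtain ⟨W, hJW, hW, hWA, hWtr⟩ : ∃ W : Matrix (Fin p) (Fin p) R, shiftMatrix R p * W = 0 ∧
      IsIdempotentElem W ∧ (∀ i j, j < i → W i j = 0) ∧ W.trace = A.trace := by
    rcases htr with h | h
    · exact ⟨0, by simp, IsIdempotentElem.zero, by simp, by simp [h]⟩
    · cases p with
      | zero =>
        exact ⟨0, by simp, IsIdempotentElem.zero, by simp, by simp [trace]⟩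
      | succ p =>
        -- Column 0 of the shift is zero, so the shift kills this idempotent of trace 1.
        refine ⟨single 0 0 1, ?_, ?_, ?_, by simp [h]⟩
        · ext i j
          rw [shiftMatrix_mul_apply
            (f := fun i (j : Fin (p + 1)) => if i = 0 ∧ j = 0 then (1 : R) else 0)]
          · simp
          · intro i j
            simp [single_apply, eq_comm (a := (0 : Fin (p + 1)))]
          · simp
        · simp [IsIdempotentElem]
        · intro i j hij
          rw [single_apply, if_neg]
          rintro ⟨rfl, rfl⟩
          exact hij.ne rfl
  obtain ⟨YA, hYA⟩ := exists_shiftMatrix_commutator (A - W)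
    (fun i j h => by rw [Matrix.sub_apply, hA i j h, hWA i j h, sub_zero]) (by simp [hWtr])
  obtain ⟨YD, hYD⟩ := exists_shiftMatrix_commutator D (fun i j h => hD i j h.le)
    (Finset.sum_eq_zero fun i _ => hD i i le_rfl)
  have hp : IsNilpotent (shiftMatrix R p) := shiftMatrix_isNilpotent
  have hq : IsNilpotent (shiftMatrix R q) := shiftMatrix_isNilpotent
  -- The upper right block asks for `J * YB - YB * (1 + J') = B`; negating it gives the Sylvester
  -- form.
  obtain ⟨YB, hYB⟩ := exists_sylvester_of_isNilpotent hp.neg hq.neg (-B)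
  obtain ⟨YC, hYC⟩ := exists_sylvester_of_isNilpotent hq hp C
  refine ⟨fromBlocks (shiftMatrix R p) 0 0 (1 + shiftMatrix R q), fromBlocks YA YB YC YD,
    fromBlocks W 0 0 0, ?_, by simp [fromBlocks_multiply, hJW], ?_⟩
  · have hB : shiftMatrix R p * YB - (YB + YB * shiftMatrix R q) = B := by
      rw [← neg_inj, ← hYB]
      simp only [Matrix.neg_mul, Matrix.mul_neg]
      abel
    have hC : YC + shiftMatrix R q * YC - YC * shiftMatrix R p = C := by
      rw [← hYC]
      abel
    have hD : YD + shiftMatrix R q * YD - (YD + YD * shiftMatrix R q) = D := by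
      rw [hYD]
      abel
    simp [fromBlocks_multiply, Matrix.mul_add, Matrix.add_mul, sub_eq_add_neg (fromBlocks _ _ _ _),
      fromBlocks_neg, fromBlocks_add, -neg_add_rev]
    simp only [← sub_eq_add_neg, hB, hC, hD, ← hYA, sub_add_cancel, and_self]
  · simp [IsIdempotentElem, fromBlocks_multiply, hW.eq]
-- Hessenberg bases and the commutator decomposition
/-- An endomorphism has a basis each vector of which is mapped to the next one, or into the span
of itself and its predecessors. -/
theorem LinearMap.exists_basis_upperHessenberg {K V : Type*} [Field K] [AddCommGroup V] [Module K V]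
    [FiniteDimensional K V] (T : V →ₗ[K] V) :
    ∃ b : Module.Basis (Fin (Module.finrank K V)) K V, ∀ i,
      (∀ j, i < j → b.repr (T (b i)) j = 0) ∨ ∃ j : Fin _, (j : ℕ) = i + 1 ∧ T (b i) = b j := by
  classical
  -- Nothing is required of the last vector yet: its image, if it leaves the span, becomes the next
  -- vector.
  have key (n : ℕ) (hn : n ≤ Module.finrank K V) : ∃ v : Fin n → V, LinearIndependent K v ∧
      ∀ i, T (v i) ∈ Submodule.span K (v '' Set.Iic i) ∨ (i : ℕ) + 1 = n ∨
        ∃ j : Fin n, (j : ℕ) = i + 1 ∧ T (v i) = v j := by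
    induction n with
    | zero => exact ⟨![], linearIndependent_empty_type, fun i => i.elim0⟩
    | succ n ih =>
      obtain ⟨v, hv, hT⟩ := ih (by omega)
      obtain ⟨w, hw, hwT⟩ : ∃ w, w ∉ Submodule.span K (Set.range v) ∧
          ∀ i : Fin n, (i : ℕ) + 1 = n → T (v i) ∈ Submodule.span K (Set.range v) ∨ T (v i) = w := by
        by_cases h : ∃ i : Fin n, (i : ℕ) + 1 = n ∧ T (v i) ∉ Submodule.span K (Set.range v)
        · obtain ⟨i, hi, hi'⟩ := h
          refine ⟨_, hi', fun j hj => Or.inr ?_⟩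
          rw [show j = i from Fin.ext (by omega)]
        · push Not at h
          have : Submodule.span K (Set.range v) ≠ ⊤ := by
            intro htop
            have h1 := finrank_range_le_card (R := K) v
            rw [Set.finrank, htop, finrank_top, Fintype.card_fin] at h1
            omega
          obtain ⟨w, -, hw⟩ := SetLike.exists_of_lt this.lt_top
          exact ⟨w, hw, fun i hi => Or.inl (h i hi)⟩
      have hspan (i : Fin n) : Submodule.span K (v '' Set.Iic i) ≤
          Submodule.span K ((Fin.snoc v w : Fin (n + 1) → V) '' Set.Iic i.castSucc) := by
        refine Submodule.span_mono ?_
        rintro _ ⟨j, hj, rfl⟩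
        exact ⟨j.castSucc, Fin.castSucc_le_castSucc_iff.2 hj, by simp⟩
      refine ⟨Fin.snoc v w, linearIndependent_finSnoc.2 ⟨hv, hw⟩, fun i => ?_⟩
      refine Fin.lastCases (Or.inr (Or.inl (by simp))) (fun i => ?_) i
      rw [Fin.snoc_castSucc]
      rcases hT i with h | h | ⟨j, hj, h⟩
      · exact Or.inl (hspan i h)
      · rcases hwT i h with h' | h'
        · left
          refine hspan i ?_
          have : Set.Iic i = Set.univ := by
            ext j
            simp only [Set.mem_Iic, Set.mem_univ, iff_true, Fin.le_def]
            omega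
          rwa [this, Set.image_univ]
        · exact Or.inr (Or.inr ⟨Fin.last n, by simp [h], by simp [h']⟩)
      · exact Or.inr (Or.inr ⟨j.castSucc, by simp [hj], by simp [h]⟩)
  obtain ⟨v, hv, hT⟩ := key _ le_rfl
  let b := Module.Basis.mk hv (hv.span_eq_top_of_card_eq_finrank' (Fintype.card_fin _)).ge
  have hcoe : ⇑b = v := Module.Basis.coe_mk _ _
  refine ⟨b, fun i => ?_⟩
  rw [← hcoe] at hT
  rcases hT i with h | h | h
  · left
    intro j hij
    have hb := b.repr_support_subset_of_mem_span _ h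
    by_contra hne
    have := hb (Finsupp.mem_support_iff.2 hne)
    exact absurd hij (not_lt.2 this)
  · left
    intro j hij
    have := Fin.lt_def.1 hij
    omega
  · exact Or.inr h

/-- Backward two-colouring of the natural numbers: the colour is prescribed on `s`, and
elsewhere it differs from the colour of the next number. -/
theorem exists_coloring_ne_succ (s : ℕ → Prop) (n : ℕ) :
    ∃ c : ℕ → Bool, ∀ i < n, (s i → c i = true) ∧ (¬ s i → c i ≠ c (i + 1)) := by
  classical
  induction n generalizing s with
  | zero => exact ⟨fun _ => true, by simp⟩
  | succ n ih =>
    obtain ⟨c, hc⟩ := ih fun i => s (i + 1)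
    refine ⟨fun i => Nat.casesOn i (if s 0 then true else !c 0) c, fun i hi => ?_⟩
    cases i with
    | zero => by_cases h : s 0 <;> simp [h]
    | succ i => exact hc i (by omega)

/-- The core decomposition: a matrix of trace `0` or `1` is a commutator `x * y - y * x` plus an
idempotent killed by `x`. -/
theorem Matrix.isCommutatorAddIdempotent_of_trace {K ι : Type*} [Field K] [Fintype ι]
    [DecidableEq ι] (T : Matrix ι ι K) (hT : T.trace = 0 ∨ T.trace = 1) :
    IsCommutatorAddIdempotent T := by
  classical
  obtain ⟨b, hb⟩ := (toLin' T).exists_basis_upperHessenberg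
  generalize Module.finrank K (ι → K) = n at b
  let M := LinearMap.toMatrix b b (toLin' T)
  have hM (i j) : M i j = b.repr (toLin' T (b j)) i := LinearMap.toMatrix_apply ..
  have hMtr : M.trace = T.trace := by
    rw [← LinearMap.trace_eq_matrix_trace, Matrix.trace_toLin'_eq]
  -- A column with a nonzero entry below the diagonal has a single 1, just below it. Changing colour
  -- there moves that 1 to an off-diagonal block. All columns coloured `false` are of this kind,
  -- hence have zero diagonal entry.
  obtain ⟨c, hc⟩ := exists_coloring_ne_succ
    (fun i => ∀ h : i < n, ∀ j, ⟨i, h⟩ < j → M j ⟨i, h⟩ = 0) n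
  have next (i : Fin n) (hi : c i ≠ true ∨ ¬ ∀ j, i < j → M j i = 0) :
      c i ≠ c (i + 1) ∧ ∃ j : Fin n, (j : ℕ) = i + 1 ∧ toLin' T (b i) = b j := by
    have hs : ¬ ∀ j, i < j → M j i = 0 := by
      rcases hi with hi | hi
      · exact fun h => hi ((hc i i.2).1 fun _ => h)
      · exact hi
    refine ⟨(hc i i.2).2 fun h => hs (h i.2), (hb i).resolve_left ?_⟩
    simpa only [hM] using hs
  have lower (i j : Fin n) (hij : j < i) (hcij : c i = c j) : M i j = 0 := by
    by_contra hne
    obtain ⟨h1, k, hk, hT⟩ := next j (Or.inr fun h => hne (h i hij))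
    have hki : k = i := by
      by_contra hki
      exact hne (by rw [hM, hT, b.repr_self, Finsupp.single_eq_of_ne (Ne.symm hki)])
    rw [← hk, hki] at h1
    exact h1 hcij.symm
  have diag (i : Fin n) (hi : c i ≠ true) : M i i = 0 := by
    obtain ⟨-, k, hk, hT⟩ := next i (Or.inl hi)
    rw [hM, hT, b.repr_self, Finsupp.single_eq_of_ne]
    rintro rfl
    omega
  let s : Finset (Fin n) := {i | c i = true}
  let e : Fin s.card ⊕ Fin sᶜ.card ≃ Fin n :=
    (Equiv.sumCongr (s.orderIsoOfFin rfl).toEquiv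
      ((sᶜ.orderIsoOfFin rfl).toEquiv.trans (Equiv.subtypeEquivRight (by simp)))).trans
      (Equiv.sumCompl (· ∈ s))
  have hel (i) : e (Sum.inl i) = s.orderEmbOfFin rfl i := rfl
  have her (i) : e (Sum.inr i) = sᶜ.orderEmbOfFin rfl i := rfl
  have hcl (i) : c (e (Sum.inl i)) = true := by
    have := s.orderEmbOfFin_mem rfl i
    rw [hel]
    exact (Finset.mem_filter.1 this).2
  have hcr (i) : c (e (Sum.inr i)) = false := by
    have := sᶜ.orderEmbOfFin_mem rfl i
    rw [her, ← Bool.not_eq_true]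
    exact fun h => Finset.mem_compl.1 this (Finset.mem_filter.2 ⟨Finset.mem_univ _, h⟩)
  let N := M.submatrix e e
  have hD (i j) (hij : j ≤ i) : N.toBlocks₂₂ i j = 0 := by
    rcases hij.eq_or_lt with rfl | hij
    · exact diag _ (by simp [hcr])
    · exact lower _ _ (by simpa [her] using hij) (by rw [hcr, hcr])
  have hA (i j) (hij : j < i) : N.toBlocks₁₁ i j = 0 :=
    lower _ _ (by simpa [hel] using hij) (by rw [hcl, hcl])
  have hNtr : N.toBlocks₁₁.trace = T.trace := by
    have h : N.trace = M.trace := Equiv.sum_comp e fun i => M i i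
    have h' : N.toBlocks₂₂.trace = 0 := Finset.sum_eq_zero fun i _ => hD i i le_rfl
    have h'' : N.trace = N.toBlocks₁₁.trace + N.toBlocks₂₂.trace := Fintype.sum_sum_type _
    rw [← hMtr, ← h, h'', h', add_zero]
  have hN : IsCommutatorAddIdempotent N := by
    rw [← fromBlocks_toBlocks N]
    exact isCommutatorAddIdempotent_fromBlocks _ _ _ _ hA hD (by rwa [hNtr])
  have hTN : toLinAlgEquiv'.symm ((LinearMap.toMatrixAlgEquiv b).symm
      (reindexAlgEquiv K K e N)) = T := by
    have : reindexAlgEquiv K K e N = M := by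
      simp [N]
    rw [this, AlgEquiv.symm_apply_eq, AlgEquiv.symm_apply_eq]
    rfl
  rw [← hTN]
  exact ((hN.map (reindexAlgEquiv K K e : _ ≃ₐ[K] _).toRingEquiv.toRingHom).map
    (LinearMap.toMatrixAlgEquiv b).symm.toRingEquiv.toRingHom).map
    toLinAlgEquiv'.symm.toRingEquiv.toRingHom

/-! ### Sums of three idempotents -/

/-- A rank factorisation `A = B * C`, with a left inverse of `B` and a right inverse of `C`. -/
theorem Matrix.exists_rank_factorization {K m n : Type*} [Field K] [Fintype m] [DecidableEq m]
    [Fintype n] [DecidableEq n] (A : Matrix m n K) :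
    ∃ (r : ℕ) (B : Matrix m (Fin r) K) (C : Matrix (Fin r) n K) (B' : Matrix (Fin r) m K)
      (C' : Matrix n (Fin r) K), A = B * C ∧ B' * B = 1 ∧ C * C' = 1 := by
  let f := toLin' A
  let b := Module.finBasis K f.range
  let φ := b.equivFun
  obtain ⟨g, hg⟩ := (f.range.subtype ∘ₗ φ.symm.toLinearMap).exists_leftInverse_of_injective
    (by rw [LinearMap.ker_eq_bot]; exact Subtype.val_injective.comp φ.symm.injective)
  obtain ⟨h, hh⟩ := (φ.toLinearMap ∘ₗ f.rangeRestrict).exists_rightInverse_of_surjective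
    (by rw [LinearMap.range_eq_top]; exact φ.surjective.comp f.surjective_rangeRestrict)
  refine ⟨_, LinearMap.toMatrix' (f.range.subtype ∘ₗ φ.symm.toLinearMap),
    LinearMap.toMatrix' (φ.toLinearMap ∘ₗ f.rangeRestrict), LinearMap.toMatrix' g,
    LinearMap.toMatrix' h, ?_, ?_, ?_⟩
  · rw [← LinearMap.toMatrix'_comp, ← LinearMap.toMatrix'_toLin' A]
    congr 1
    ext
    simp [f]
  · rw [← LinearMap.toMatrix'_comp, hg, LinearMap.toMatrix'_id]
  · rw [← LinearMap.toMatrix'_comp, hh, LinearMap.toMatrix'_id]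

/-- An element of a ring that is a sum of three idempotents. -/
def IsSumOfThreeIdempotents {R : Type*} [Semiring R] (a : R) : Prop :=
  ∃ p q r : R, IsIdempotentElem p ∧ IsIdempotentElem q ∧ IsIdempotentElem r ∧ a = p + q + r

theorem IsSumOfThreeIdempotents.map {R S : Type*} [Semiring R] [Semiring S] {a : R}
    (ha : IsSumOfThreeIdempotents a) (f : R →+* S) : IsSumOfThreeIdempotents (f a) := by
  obtain ⟨p, q, r, hp, hq, hr, rfl⟩ := ha
  exact ⟨f p, f q, f r, hp.map f, hq.map f, hr.map f, by simp⟩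

theorem IsSumOfThreeIdempotents.conj {R : Type*} [Semiring R] {a u v : R}
    (ha : IsSumOfThreeIdempotents a) (huv : u * v = 1) : IsSumOfThreeIdempotents (v * a * u) := by
  have key {p : R} (hp : IsIdempotentElem p) : IsIdempotentElem (v * p * u) := by
    calc v * p * u * (v * p * u) = v * p * (u * v) * p * u := by simp only [mul_assoc]
      _ = v * (p * p) * u := by rw [huv, mul_one, mul_assoc v p p]
      _ = v * p * u := by rw [hp.eq]
  obtain ⟨p, q, r, hp, hq, hr, rfl⟩ := ha
  exact ⟨_, _, _, key hp, key hq, key hr, by simp only [mul_add, add_mul]⟩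

theorem Matrix.add_self_eq_zero_of_charP_two {R m n : Type*} [Ring R] [CharP R 2]
    (M : Matrix m n R) : M + M = 0 := by
  ext i j
  exact CharTwo.add_self_eq_zero _

/-- Matrices `[1, *; 0, 0]` and `[1, 0; *, 0]` are idempotent, and their corners add to `1 + 1 = 0`;
so only the diagonal blocks matter. -/
theorem Matrix.isSumOfThreeIdempotents_fromBlocks {R m n : Type*} [Ring R] [CharP R 2]
    [Fintype m] [DecidableEq m] [Fintype n] [DecidableEq n] {A : Matrix m m R} {B B' : Matrix m n R}
    {C C' : Matrix n m R} {D : Matrix n n R} (h : IsIdempotentElem (fromBlocks A B C D)) :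
    IsSumOfThreeIdempotents (fromBlocks A B' C' D) := by
  refine ⟨fromBlocks A B C D, fromBlocks 1 (B' - B) 0 0, fromBlocks 1 0 (C' - C) 0, h,
    by simp [IsIdempotentElem, fromBlocks_multiply],
    by simp [IsIdempotentElem, fromBlocks_multiply], ?_⟩
  simp [fromBlocks_add, add_assoc, add_self_eq_zero_of_charP_two]

/-- The matrix is a sum of two orthogonal idempotents: `[B; B * y] * [l, x * B']`, where row times
column is `l * B + x * y = 1`, and `[0; B * w] * [-w * y * B', w * B']`. Orthogonality uses `x * w =
0`. -/
theorem Matrix.isIdempotentElem_fromBlocks_of_mul_eq {R m k : Type*} [Ring R] [Fintype m]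
    [DecidableEq m] [Fintype k] [DecidableEq k] {B : Matrix m k R} {B' l : Matrix k m R}
    {x y w : Matrix k k R} (hB : B' * B = 1) (hl : l * B = 1 - x * y) (hxw : x * w = 0)
    (hw : IsIdempotentElem w) :
    IsIdempotentElem (fromBlocks (B * l) (B * (x * B')) (B * (y * l - w * y * B'))
      (B * ((y * x + w) * B'))) := by
  have hl' (M : Matrix k m R) : l * (B * M) = M - x * (y * M) := by
    rw [← Matrix.mul_assoc, hl, Matrix.sub_mul, Matrix.one_mul, Matrix.mul_assoc]
  have hB' (M : Matrix k m R) : B' * (B * M) = M := by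
    rw [← Matrix.mul_assoc, hB, Matrix.one_mul]
  have hxw' (M : Matrix k m R) : x * (w * M) = 0 := by
    rw [← Matrix.mul_assoc, hxw, Matrix.zero_mul]
  have hw' (M : Matrix k m R) : w * (w * M) = w * M := by
    rw [← Matrix.mul_assoc, hw.eq]
  rw [IsIdempotentElem, fromBlocks_multiply]
  congr 1 <;>
  · simp only [Matrix.mul_assoc, Matrix.mul_add, Matrix.add_mul, Matrix.mul_sub, Matrix.sub_mul,
      hl', hB', hxw', hw', Matrix.mul_zero]
    abel

theorem Matrix.isSumOfThreeIdempotents_fromBlocks_zero {K ι : Type*} [Field K] [CharP K 2]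
    [Fintype ι] [DecidableEq ι] (A : Matrix ι ι K) (hA : A.trace = 0 ∨ A.trace = 1) :
    IsSumOfThreeIdempotents (fromBlocks A 0 0 (0 : Matrix ι ι K)) := by
  obtain ⟨r, B, C, B', C', rfl, hB, hC⟩ := A.exists_rank_factorization
  have htr : (C * B - 1).trace = 0 ∨ (C * B - 1).trace = 1 := by
    have hr : (r : K) = 0 ∨ (r : K) = 1 := by
      rcases Nat.even_or_odd r with h | h
      · exact Or.inl ((CharP.cast_eq_zero_iff K 2 r).2 h.two_dvd)
      · obtain ⟨k, rfl⟩ := h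
        simp [CharTwo.two_eq_zero]
    have h1 : (1 : K) + 1 = 0 := CharTwo.add_self_eq_zero 1
    rw [trace_sub, trace_one, Fintype.card_fin, trace_mul_comm, CharTwo.sub_eq_add]
    rcases hA with hA | hA <;> rcases hr with hr | hr <;> simp [hA, hr, h1]
  obtain ⟨x, y, w, hT, hxw, hw⟩ := isCommutatorAddIdempotent_of_trace _ htr
  let Z := (y * x + w) * B'
  have hl : (C + Z) * B = 1 - x * y := by
    have hCB : C * B = 1 + (x * y - y * x + w) := by rw [← hT]; abel
    have hZB : Z * B = y * x + w := by rw [Matrix.mul_assoc, hB, Matrix.mul_one]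
    calc (C + Z) * B = 1 - x * y + (x * y + x * y) + (w + w) := by
          rw [Matrix.add_mul, hCB, hZB]; abel
      _ = 1 - x * y := by simp only [add_self_eq_zero_of_charP_two, add_zero]
  have hP := isIdempotentElem_fromBlocks_of_mul_eq hB hl hxw hw
  have hM := isSumOfThreeIdempotents_fromBlocks (B' := B * Z) (C' := B * (C + Z)) hP
  let S := C' * Z
  have hS : C * S = Z := by rw [← Matrix.mul_assoc, hC, Matrix.one_mul]
  have hSS : S + S = 0 := S.add_self_eq_zero_of_charP_two
  -- Since `C * S = Z`, the column operations in `u` turn each block row `[B * (C + Z), B * Z]` into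
  -- `[B * C, 0]`; then `v` clears the second row, as `S + S = 0`.
  have key := hM.conj (u := fromBlocks 1 S 1 (1 + S)) (v := fromBlocks (1 + S) S 1 1) ?_
  · convert key using 1
    have h1 : B * (C + Z) + B * Z = B * C := by
      rw [Matrix.mul_add, add_assoc, add_self_eq_zero_of_charP_two, add_zero]
    have h2 : B * (C + Z) * S + B * Z * (1 + S) = 0 := by
      calc B * (C + Z) * S + B * Z * (1 + S)
          = B * (C * S) + B * Z + (B * Z * S + B * Z * S) := by
            simp only [Matrix.mul_add, Matrix.add_mul, Matrix.mul_one, Matrix.mul_assoc]; abel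
        _ = 0 := by simp only [hS, add_self_eq_zero_of_charP_two, add_zero]
    rw [Matrix.mul_assoc, fromBlocks_multiply, fromBlocks_multiply]
    change _ = fromBlocks ((1 + S) * (B * (C + Z) * 1 + B * Z * 1) +
      S * (B * (C + Z) * 1 + B * Z * 1)) ((1 + S) * (B * (C + Z) * S + B * Z * (1 + S)) +
      S * (B * (C + Z) * S + B * Z * (1 + S))) (1 * (B * (C + Z) * 1 + B * Z * 1) +
      1 * (B * (C + Z) * 1 + B * Z * 1)) (1 * (B * (C + Z) * S + B * Z * (1 + S)) +
      1 * (B * (C + Z) * S + B * Z * (1 + S)))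
    simp only [Matrix.mul_one, Matrix.one_mul, h1, h2, Matrix.mul_zero, add_zero,
      ← Matrix.add_mul, add_assoc, hSS, add_self_eq_zero_of_charP_two]
  · rw [fromBlocks_multiply, ← fromBlocks_one]
    congr 1
    · simp [add_assoc, hSS]
    · simp [hSS]
    · simp [add_self_eq_zero_of_charP_two]
    · simp [add_left_comm S, hSS]

theorem theorem4 {F : Type*} [Field F] [CharP F 2] (n : ℕ) (A : Matrix (Fin n) (Fin n) F)
    (hA : A.trace = 0 ∨ A.trace = 1) :
    ∃ P Q R : Matrix (Fin (2 * n)) (Fin (2 * n)) F,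
      IsIdempotentElem P ∧ IsIdempotentElem Q ∧ IsIdempotentElem R ∧
        directSum A (0 : Matrix (Fin n) (Fin n) F) = P + Q + R :=
  (isSumOfThreeIdempotents_fromBlocks_zero A hA).map (reindexAlgEquiv F F
    (finSumFinEquiv.trans (finCongr (two_mul n).symm))).toRingEquiv.toRingHom
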